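/- Let $G=U(1)\times SU(2)$ with Lie algebra $\mathfrak g=u(1)\oplus su(2)$, let $g_0$ be a bi-invariant and $g_l$ a left-invariant Riemannian metric on $G$. Let $u_1,u_2,u_3$ be a $g_0$-orthonormal basis of $su(2)$ consisting of eigenvectors of the restriction of $g_l$ to $su(2)$, i.e. $g_l(u_i,v)=\lambda_i^2\,g_0(u_i,v)$ for all $v\in su(2)$, with $\lambda_i>0$, and put $e_i=u_i/\lambda_i$. Let $e_0\neq 0$ span $u(1)$, and let $E_0\in\mathfrak g$ be a $g_l$-unit vector that is $g_l$-orthogonal to $su(2)$. Write $E_0=ae_0+b_1e_1+b_2e_2+b_3e_3$ with real coefficients and $\hat E_0=b_1e_1+b_2e_2+b_3e_3$. Assume that $g_l$ is twisted, meaning that either $\lambda_1=\lambda_2=\lambda_3$, or $\lambda_i=\lambda_j$ and $E_0\in\operatorname{span}\{e_0,e_k\}$ for some $\{i,j,k\}=\{1,2,3\}$. Let $\tilde g_l$ be the pull-back of $g_l$ to $\mathbb R\times SU(2)$ under the universal covering $(t,g)\mapsto(\exp(te_0),g)$, by means of which $e_0$ is identified with $\partial/\partial t$. Let $g'$ be the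 (left-invariant) product metric on $\mathbb R\times SU(2)$ for which the left-invariant fields $e_0,e_1,e_2,e_3$ are orthonormal. If $g_l$ has nonnegative sectional curvature, then the map $$f:(\mathbb R\times SU(2),g')\to(\mathbb R\times SU(2),\tilde g_l),\qquad f(t,g)=\bigl(at,\;g\exp(t\hat E_0)\bigr),$$ is an isometry of Riemannian manifolds, that is, a diffeomorphism with $f^*\tilde g_l=g'$. -/

import Mathlib

open scoped Manifold ContDiff

section SpecialUnitary

open Matrix Complex Metric

/-- The special unitary group `SU(2)`, as a group of complex matrices. Below it is given its usual
smooth structure, by means of the first column of a matrix, and is shown to be a Lie group. -/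
abbrev SU2 : Type := Matrix.specialUnitaryGroup (Fin 2) ℂ

/-- The unit sphere in `ℝ⁴`. -/
abbrev Sphere3 : Type := sphere (0 : EuclideanSpace ℝ (Fin 4)) 1

namespace SU2

theorem entry_01 (A : SU2) : (A : Matrix (Fin 2) (Fin 2) ℂ) 0 1 = -star ((A : Matrix (Fin 2) (Fin 2) ℂ) 1 0) ∧
    (A : Matrix (Fin 2) (Fin 2) ℂ) 1 1 = star ((A : Matrix (Fin 2) (Fin 2) ℂ) 0 0) := by
  obtain ⟨A, hA⟩ := A
  obtain ⟨hU, hd⟩ := Matrix.mem_specialUnitaryGroup_iff.1 hA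
  have h1 : A * star A = 1 := Matrix.mem_unitaryGroup_iff.1 hU
  have h2 : A.adjugate * A = 1 := by rw [Matrix.adjugate_mul, hd, one_smul]
  have h3 : star A = A.adjugate := by
    calc star A = (A.adjugate * A) * star A := by rw [h2, one_mul]
      _ = A.adjugate := by rw [mul_assoc, h1, mul_one]
  rw [Matrix.adjugate_fin_two] at h3
  have h00 := congrFun (congrFun h3 0) 0
  have h01 := congrFun (congrFun h3 0) 1
  simp [Matrix.star_apply] at h00 h01
  simp [h00, h01]

/-- The point of the unit sphere in `ℝ⁴` given by the first column of a matrix in `SU(2)`. -/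
noncomputable def toVec (A : Matrix (Fin 2) (Fin 2) ℂ) : EuclideanSpace ℝ (Fin 4) :=
  !₂[(A 0 0).re, (A 0 0).im, (A 1 0).re, (A 1 0).im]

/-- The matrix with rows `(z, -w̄)` and `(w, z̄)`, where `z = x₀ + i x₁` and `w = x₂ + i x₃`. -/
noncomputable def ofVec (x : EuclideanSpace ℝ (Fin 4)) : Matrix (Fin 2) (Fin 2) ℂ :=
  !![⟨x 0, x 1⟩, ⟨-x 2, x 3⟩; ⟨x 2, x 3⟩, ⟨x 0, -x 1⟩]

theorem toVec_mem (A : SU2) : toVec A ∈ sphere (0 : EuclideanSpace ℝ (Fin 4)) 1 := by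
  have hd := (Matrix.mem_specialUnitaryGroup_iff.1 A.2).2
  rw [Matrix.det_fin_two, (entry_01 A).1, (entry_01 A).2] at hd
  have := congrArg Complex.re hd
  simp at this
  simp [EuclideanSpace.norm_eq, Fin.sum_univ_four, toVec]
  linarith

theorem ofVec_mem (x : Sphere3) : ofVec x ∈ Matrix.specialUnitaryGroup (Fin 2) ℂ := by
  obtain ⟨x, hx⟩ := x
  simp [EuclideanSpace.norm_eq, Fin.sum_univ_four] at hx
  rw [Matrix.mem_specialUnitaryGroup_iff, Matrix.mem_unitaryGroup_iff]
  constructor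
  · ext i j
    fin_cases i <;> fin_cases j <;>
      simp [ofVec, Matrix.mul_apply, Matrix.star_apply, Complex.ext_iff] <;>
      constructor <;> linarith
  · simp [ofVec, Matrix.det_fin_two, Complex.ext_iff]
    constructor <;> linarith

/-- The homeomorphism between `SU(2)` and the unit sphere in `ℝ⁴` given by the first column. -/
noncomputable def homeoSphere : SU2 ≃ₜ Sphere3 where
  toFun A := ⟨toVec A, toVec_mem A⟩
  invFun x := ⟨ofVec x, ofVec_mem x⟩
  left_inv A := by
    apply Subtype.ext
    ext i j
    fin_cases i <;> fin_cases j <;>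
      simp [ofVec, toVec, (entry_01 A).1, (entry_01 A).2, Complex.ext_iff]
  right_inv x := by
    apply Subtype.ext
    ext i
    fin_cases i <;> simp [ofVec, toVec]
  continuous_toFun := by
    refine Continuous.subtype_mk ?_ _
    unfold toVec
    refine (PiLp.continuous_toLp 2 _).comp (continuous_pi fun i => ?_)
    have h (i j : Fin 2) : Continuous fun A : SU2 => (A : Matrix (Fin 2) (Fin 2) ℂ) i j :=
      continuous_subtype_val.matrix_elem i j
    fin_cases i
    · exact Complex.continuous_re.comp (h 0 0)
    · exact Complex.continuous_im.comp (h 0 0)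
    · exact Complex.continuous_re.comp (h 1 0)
    · exact Complex.continuous_im.comp (h 1 0)
  continuous_invFun := by
    refine Continuous.subtype_mk (continuous_matrix fun i j => ?_) _
    have h (k : Fin 4) : Continuous fun x : Sphere3 => (x : EuclideanSpace ℝ (Fin 4)) k := by fun_prop
    have e (a b : ℝ) : (⟨a, b⟩ : ℂ) = a + b * I := Complex.mk_eq_add_mul_I a b
    fin_cases i <;> fin_cases j <;> simp [ofVec, e] <;> fun_prop

/-- The smooth structure of `SU(2)`: that of the unit sphere in `ℝ⁴`. -/
noncomputable instance : ChartedSpace (EuclideanSpace ℝ (Fin 3)) SU2 where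
  atlas := {e | ∃ c ∈ atlas (EuclideanSpace ℝ (Fin 3)) Sphere3,
    e = homeoSphere.toOpenPartialHomeomorph ≫ₕ c}
  chartAt A := homeoSphere.toOpenPartialHomeomorph ≫ₕ
    chartAt (EuclideanSpace ℝ (Fin 3)) (homeoSphere A)
  mem_chart_source A := by simp
  chart_mem_atlas A := ⟨_, chart_mem_atlas _ _, rfl⟩

instance : IsManifold (𝓡 3) ω SU2 := by
  refine isManifold_of_contDiffOn (𝓡 3) ω SU2 ?_
  rintro _ _ ⟨c, hc, rfl⟩ ⟨c', hc', rfl⟩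
  have h := ((contDiffGroupoid ω (𝓡 3)).compatible hc hc')
  rw [contDiffGroupoid, mem_groupoid_of_pregroupoid] at h
  have h1 := h.1
  simp only [contDiffPregroupoid] at h1
  have e : (homeoSphere.toOpenPartialHomeomorph ≫ₕ c).symm ≫ₕ
      homeoSphere.toOpenPartialHomeomorph ≫ₕ c' = c.symm ≫ₕ c' := by
    ext x <;> simp
  rw [e]
  exact h1

theorem contMDiff_homeoSphere : ContMDiff (𝓡 3) (𝓡 3) ω homeoSphere := by
  intro A
  rw [contMDiffAt_iff]
  refine ⟨homeoSphere.continuous.continuousAt, ?_⟩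
  have := (contMDiffAt_iff.1 (contMDiff_id (I := 𝓡 3) (n := ω) (M := Sphere3) (homeoSphere A))).2
  convert! this using 1
  ext x
  simp [extChartAt, chartAt, ChartedSpace.chartAt]

theorem contMDiff_homeoSphere_symm : ContMDiff (𝓡 3) (𝓡 3) ω homeoSphere.symm := by
  intro x
  rw [contMDiffAt_iff]
  refine ⟨homeoSphere.symm.continuous.continuousAt, ?_⟩
  have := (contMDiffAt_iff.1 (contMDiff_id (I := 𝓡 3) (n := ω) (M := Sphere3) x)).2
  convert! this using 1
  ext x
  simp [extChartAt, chartAt, ChartedSpace.chartAt]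


instance : Fact (Module.finrank ℝ (EuclideanSpace ℝ (Fin 4)) = 3 + 1) :=
  ⟨finrank_euclideanSpace_fin⟩

theorem contMDiff_entry (i j : Fin 2) : ContMDiff (𝓡 3) 𝓘(ℝ, ℂ) ω
    fun A : SU2 => (A : Matrix (Fin 2) (Fin 2) ℂ) i j := by
  have hc : ContMDiff (𝓡 3) 𝓘(ℝ, EuclideanSpace ℝ (Fin 4)) ω
      fun A : SU2 => (homeoSphere A : EuclideanSpace ℝ (Fin 4)) :=
    (contMDiff_coe_sphere (n := 3)).comp contMDiff_homeoSphere
  have hv : ContDiff ℝ ω fun x : EuclideanSpace ℝ (Fin 4) => ofVec x i j := by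
    have e (a b : ℝ) : (⟨a, b⟩ : ℂ) = a + b * I := Complex.mk_eq_add_mul_I a b
    have hk (k : Fin 4) : ContDiff ℝ ω fun x : EuclideanSpace ℝ (Fin 4) => ((x k : ℝ) : ℂ) :=
      Complex.ofRealCLM.contDiff.comp (by fun_prop)
    fin_cases i <;> fin_cases j <;> simp [ofVec, e] <;> fun_prop
  have h := hv.contMDiff.comp hc
  convert! h using 1
  ext A
  have : A = homeoSphere.symm (homeoSphere A) := by simp
  conv_lhs => rw [this]
  rfl

theorem contMDiff_of_entries {F : Type*} [NormedAddCommGroup F] [NormedSpace ℝ F]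
    {H : Type*} [TopologicalSpace H] {J : ModelWithCorners ℝ F H} {M : Type*} [TopologicalSpace M]
    [ChartedSpace H M] {n : ℕ∞ω} [IsManifold J n M] {f : M → SU2}
    (hf : ∀ i j, ContMDiff J 𝓘(ℝ, ℂ) n fun x => (f x : Matrix (Fin 2) (Fin 2) ℂ) i j) :
    ContMDiff J (𝓡 3) n f := by
  have hE : ContMDiff J 𝓘(ℝ, EuclideanSpace ℝ (Fin 4)) n fun x => toVec (f x) := by
    have h1 : ContMDiff J 𝓘(ℝ, Fin 4 → ℝ) n
        fun x => (![(f x : Matrix (Fin 2) (Fin 2) ℂ) 0 0 |>.re, (f x : Matrix (Fin 2) (Fin 2) ℂ) 0 0 |>.im,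
          (f x : Matrix (Fin 2) (Fin 2) ℂ) 1 0 |>.re, (f x : Matrix (Fin 2) (Fin 2) ℂ) 1 0 |>.im] : Fin 4 → ℝ) := by
      rw [contMDiff_pi_space]
      intro i
      fin_cases i
      · exact Complex.reCLM.contDiff.contMDiff.comp (hf 0 0)
      · exact Complex.imCLM.contDiff.contMDiff.comp (hf 0 0)
      · exact Complex.reCLM.contDiff.contMDiff.comp (hf 1 0)
      · exact Complex.imCLM.contDiff.contMDiff.comp (hf 1 0)
    exact (EuclideanSpace.equiv (Fin 4) ℝ).symm.contDiff.contMDiff.comp h1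
  have h2 := hE.codRestrict_sphere (n := 3) fun x => toVec_mem (f x)
  have h3 := (contMDiff_homeoSphere_symm.of_le le_top).comp h2
  convert! h3 using 1
  ext1 x
  exact (homeoSphere.symm_apply_apply (f x)).symm

instance : LieGroup (𝓡 3) ω SU2 where
  contMDiff_mul := by
    refine contMDiff_of_entries fun i j => ?_
    simp only [Submonoid.coe_mul, Matrix.mul_apply, Fin.sum_univ_two]
    have h1 (k l : Fin 2) := (contMDiff_entry k l).comp
      (contMDiff_fst (I := 𝓡 3) (J := 𝓡 3) (M := SU2) (N := SU2))
    have h2 (k l : Fin 2) := (contMDiff_entry k l).comp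
      (contMDiff_snd (I := 𝓡 3) (J := 𝓡 3) (M := SU2) (N := SU2))
    have hm : ContDiff ℝ ω fun z : ℂ × ℂ => z.1 * z.2 := contDiff_fst.mul contDiff_snd
    exact (hm.contMDiff.comp ((h1 i 0).prodMk_space (h2 0 j))).add
      (hm.contMDiff.comp ((h1 i 1).prodMk_space (h2 1 j)))
  contMDiff_inv := by
    refine contMDiff_of_entries fun i j => ?_
    exact Complex.conjCLE.contDiff.contMDiff.comp (contMDiff_entry j i)

/-- The matrix in `su(2)` given by a tangent vector `X` of `SU(2)` at the identity: its entries are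
the derivatives in the direction `X` of the matrix entries. -/
noncomputable def lieMatrix (X : GroupLieAlgebra (𝓡 3) SU2) : Matrix (Fin 2) (Fin 2) ℂ :=
  Matrix.of fun i j =>
    mvfderiv (𝓡 3) (fun A : SU2 => (A : Matrix (Fin 2) (Fin 2) ℂ) i j) 1 X

theorem mdifferentiable_entry (i j : Fin 2) : MDifferentiableAt (𝓡 3) 𝓘(ℝ, ℂ)
    (fun A : SU2 => (A : Matrix (Fin 2) (Fin 2) ℂ) i j) 1 :=
  (contMDiff_entry i j).mdifferentiable (by simp) 1

theorem mvfderiv_clm (i j : Fin 2) {F : Type*} [NormedAddCommGroup F] [NormedSpace ℝ F]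
    (L : ℂ →L[ℝ] F) (X : GroupLieAlgebra (𝓡 3) SU2) :
    mvfderiv (𝓡 3) (fun A : SU2 => L ((A : Matrix (Fin 2) (Fin 2) ℂ) i j)) 1 X =
      L (lieMatrix X i j) := by
  have h := L.hasMFDerivAt.comp (1 : SU2) (mdifferentiable_entry i j).hasMFDerivAt
  have h' := congrArg (fun T => T X) h.mfderiv
  exact h'

theorem lieMatrix_entries (X : GroupLieAlgebra (𝓡 3) SU2) :
    lieMatrix X 0 1 = -star (lieMatrix X 1 0) ∧ lieMatrix X 1 1 = star (lieMatrix X 0 0) ∧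
      (lieMatrix X 0 0).re = 0 := by
  refine ⟨?_, ?_, ?_⟩
  · rw [show -star (lieMatrix X 1 0) = (-(Complex.conjCLE : ℂ →L[ℝ] ℂ)) (lieMatrix X 1 0) from rfl,
      ← mvfderiv_clm]
    refine congrArg (fun f => mvfderiv (𝓡 3) f (1 : SU2) X) (funext fun A => ?_)
    exact (entry_01 A).1
  · rw [show star (lieMatrix X 0 0) = (Complex.conjCLE : ℂ →L[ℝ] ℂ) (lieMatrix X 0 0) from rfl,
      ← mvfderiv_clm]
    refine congrArg (fun f => mvfderiv (𝓡 3) f (1 : SU2) X) (funext fun A => ?_)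
    exact (entry_01 A).2
  · let r (L : ℂ →L[ℝ] ℝ) (i : Fin 2) : SU2 → ℝ :=
      fun A => L ((A : Matrix (Fin 2) (Fin 2) ℂ) i 0)
    have hr (L i) : MDifferentiableAt (𝓡 3) 𝓘(ℝ, ℝ) (r L i) 1 :=
      L.mdifferentiableAt.comp (1 : SU2) (mdifferentiable_entry i 0)
    have hc : (r reCLM 0 * r reCLM 0 + r imCLM 0 * r imCLM 0) +
        (r reCLM 1 * r reCLM 1 + r imCLM 1 * r imCLM 1) = fun _ => 1 := by
      ext1 A
      have hd := (Matrix.mem_specialUnitaryGroup_iff.1 A.2).2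
      rw [Matrix.det_fin_two, (entry_01 A).1, (entry_01 A).2] at hd
      have := congrArg Complex.re hd
      simp at this
      simp [r]
      linarith
    have h := mvfderiv_const (I := 𝓡 3) (1 : ℝ) (x := (1 : SU2))
    have hm (L i) := (hr L i).mul (hr L i)
    rw [← hc, mvfderiv_add ((hm _ _).add (hm _ _)) ((hm _ _).add (hm _ _)),
      mvfderiv_add (hm _ _) (hm _ _), mvfderiv_add (hm _ _) (hm _ _)] at h
    simp only [mvfderiv_mul (hr _ _) (hr _ _)] at h
    have h' := congrArg (fun T => T X) h
    have hv (L i) : mvfderiv (𝓡 3) (r L i) 1 X = L (lieMatrix X i 0) := mvfderiv_clm i 0 L X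
    simp [r] at h'
    exact (hv reCLM 0).symm.trans h'

open NormedSpace in
theorem exp_mem_of {M : Matrix (Fin 2) (Fin 2) ℂ} (h1 : star M = -M) (h2 : M 1 1 = - M 0 0) :
    exp M ∈ Matrix.specialUnitaryGroup (Fin 2) ℂ := by
  have hinv : exp M * exp (-M) = 1 := by
    rw [← Matrix.exp_add_of_commute _ _ (Commute.neg_right (Commute.refl M)), add_neg_cancel,
      NormedSpace.exp_zero]
  rw [Matrix.mem_specialUnitaryGroup_iff, Matrix.mem_unitaryGroup_iff]
  constructor
  · rw [Matrix.star_eq_conjTranspose, ← Matrix.exp_conjTranspose, ← Matrix.star_eq_conjTranspose,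
      h1, hinv]
  · let J : Matrix (Fin 2) (Fin 2) ℂ := !![0, 1; -1, 0]
    have hJ : J⁻¹ = !![0, -1; 1, 0] := by
      apply Matrix.inv_eq_right_inv
      ext i j; fin_cases i <;> fin_cases j <;> simp [J]
    have hadj (A : Matrix (Fin 2) (Fin 2) ℂ) : J * Aᵀ * J⁻¹ = A.adjugate := by
      rw [Matrix.adjugate_fin_two, hJ]
      ext i j; fin_cases i <;> fin_cases j <;> simp [J, Matrix.mul_apply, Fin.sum_univ_two, Matrix.vecMul, dotProduct]
    have hM : M.adjugate = -M := by
      rw [Matrix.adjugate_fin_two]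
      ext i j; fin_cases i <;> fin_cases j <;> simp [h2]
    have hu : IsUnit J := by
      rw [Matrix.isUnit_iff_isUnit_det]; simp [J, Matrix.det_fin_two]
    have h3 : (exp M).adjugate = exp (-M) := by
      rw [← hM, ← hadj, ← hadj, Matrix.exp_conj _ _ hu, Matrix.exp_transpose]
    have h4 := Matrix.mul_adjugate (exp M)
    rw [h3, hinv] at h4
    have := congrFun (congrFun h4 0) 0
    simpa using this.symm


/-- The exponential map `su(2) → SU(2)`, given by the matrix exponential. -/
noncomputable def lieExp (X : GroupLieAlgebra (𝓡 3) SU2) : SU2 :=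
  ⟨NormedSpace.exp (lieMatrix X), by
    obtain ⟨h1, h2, h3⟩ := lieMatrix_entries X
    refine exp_mem_of ?_ ?_
    · ext i j
      fin_cases i <;> fin_cases j <;> simp [Matrix.star_apply, h1, h2, Complex.ext_iff, h3]
    · rw [h2]
      simp [Complex.ext_iff, h3]⟩

end SU2

end SpecialUnitary

section Riemannian

variable {E : Type*} [NormedAddCommGroup E] [NormedSpace ℝ E] {H : Type*} [TopologicalSpace H]
  {F : Type*} [NormedAddCommGroup F] [NormedSpace ℝ F] {H' : Type*} [TopologicalSpace H']

/-- A metric tensor on `M`, recorded as a function of two tangent vectors at each point. The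
Riemannian metrics below are compared through these functions. -/
abbrev TwoTensor (I : ModelWithCorners ℝ E H) (M : Type*) [TopologicalSpace M]
    [ChartedSpace H M] : Type _ :=
  ∀ x : M, TangentSpace I x → TangentSpace I x → ℝ

/-- A smooth Riemannian metric on the manifold `M`. -/
abbrev RiemMetric (I : ModelWithCorners ℝ E H) (M : Type*) [TopologicalSpace M]
    [ChartedSpace H M] [IsManifold I ∞ M] : Type _ :=
  Bundle.ContMDiffRiemannianMetric I ∞ E (fun x : M => TangentSpace I x)

variable {I : ModelWithCorners ℝ E H} {J : ModelWithCorners ℝ F H'}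
  {M : Type*} [TopologicalSpace M] [ChartedSpace H M]
  {N : Type*} [TopologicalSpace N] [ChartedSpace H' N]

/-- The `2`-tensor underlying a Riemannian metric. -/
noncomputable def RiemMetric.toTwoTensor [IsManifold I ∞ M] (g : RiemMetric I M) : TwoTensor I M :=
  fun x v w => g.inner x v w

/-- The pull-back of a `2`-tensor along a map. -/
noncomputable def TwoTensor.pullback (T : TwoTensor J N) (p : M → N) : TwoTensor I M :=
  fun x v w => T (p x) (mfderiv I J p x v) (mfderiv I J p x w)

/-- The product metric of two metrics. -/
noncomputable def TwoTensor.prod (S : TwoTensor I M) (T : TwoTensor J N) : TwoTensor (I.prod J) (M × N) :=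
  fun x v w => S x.1 v.1 w.1 + T x.2 v.2 w.2

/-- `f` is a Riemannian isometry from `(M, S)` to `(N, T)`: a smooth diffeomorphism whose
differential carries `S` to `T`. -/
def IsRiemannianIsometry (S : TwoTensor I M) (T : TwoTensor J N) (f : M → N) : Prop :=
  (∃ Φ : Diffeomorph I J M N ∞, ⇑Φ = f) ∧ ∀ (x : M) (v w : TangentSpace I x),
    T (f x) (mfderiv I J f x v) (mfderiv I J f x w) = S x v w

section Curvature

variable [IsManifold I ∞ M]

/-- `X` is a smooth vector field. -/
def IsSmoothField (X : ∀ x : M, TangentSpace I x) : Prop :=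
  ContMDiff I I.tangent ∞ fun x => (⟨x, X x⟩ : TangentBundle I M)

/-- `∇` is the Levi-Civita connection of `g`: it is torsion-free, and
`v ⟨Y, Z⟩ = ⟨∇_v Y, Z⟩ + ⟨Y, ∇_v Z⟩`. Here `cov Y x v` stands for `∇_v Y` at `x`. -/
def IsLeviCivita [FiniteDimensional ℝ E] [CompleteSpace E] (g : RiemMetric I M)
    (cov : CovariantDerivative I E (fun x : M => TangentSpace I x)) : Prop :=
  cov.torsion = 0 ∧
    ∀ Y Z : (∀ x : M, TangentSpace I x), IsSmoothField Y → IsSmoothField Z →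
      ∀ (x : M) (v : TangentSpace I x),
        mvfderiv I (fun y => g.inner y (Y y) (Z y)) x v =
          g.inner x (cov Y x v) (Z x) + g.inner x (Y x) (cov Z x v)

/-- The curvature `R(X, Y) Z = ∇_X ∇_Y Z - ∇_Y ∇_X Z - ∇_{[X, Y]} Z` of a connection on the
tangent bundle. -/
noncomputable def curvature (cov : CovariantDerivative I E (fun x : M => TangentSpace I x))
    (X Y Z : ∀ x : M, TangentSpace I x) (x : M) : TangentSpace I x :=
  cov (fun y => cov Z y (Y y)) x (X x) - cov (fun y => cov Z y (X y)) x (Y x) -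
    cov Z x (VectorField.mlieBracket I X Y x)

/-- The sectional curvature at `x` of the plane spanned by `X x` and `Y x`, for smooth vector
fields `X` and `Y` that are linearly independent at `x`. -/
noncomputable def sectionalCurvature (g : RiemMetric I M)
    (cov : CovariantDerivative I E (fun x : M => TangentSpace I x))
    (X Y : ∀ x : M, TangentSpace I x) (x : M) : ℝ :=
  g.inner x (curvature cov X Y Y x) (X x) /
    (g.inner x (X x) (X x) * g.inner x (Y x) (Y x) - g.inner x (X x) (Y x) ^ 2)

/-- The metric `g` has nonnegative sectional curvature. (The Levi-Civita connection exists and is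
unique on smooth vector fields.) -/
def HasNonnegSectionalCurvature [FiniteDimensional ℝ E] [CompleteSpace E]
    (g : RiemMetric I M) : Prop :=
  ∃ cov : CovariantDerivative I E (fun x : M => TangentSpace I x), IsLeviCivita g cov ∧
    ∀ X Y : (∀ x : M, TangentSpace I x), IsSmoothField X → IsSmoothField Y →
      ∀ x : M, LinearIndependent ℝ ![X x, Y x] → 0 ≤ sectionalCurvature g cov X Y x

end Curvature

section LieGroup

variable {G : Type*} [TopologicalSpace G] [ChartedSpace H G] [Group G]

/-- The metric `g` on a Lie group is invariant under left translations. -/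
def IsLeftInvariant [IsManifold I ∞ G] (g : RiemMetric I G) : Prop :=
  ∀ (h x : G) (v w : TangentSpace I x),
    g.inner (h * x) (mfderiv I I (h * ·) x v) (mfderiv I I (h * ·) x w) = g.inner x v w

/-- The metric `g` on a Lie group is invariant under right translations. -/
def IsRightInvariant [IsManifold I ∞ G] (g : RiemMetric I G) : Prop :=
  ∀ (h x : G) (v w : TangentSpace I x),
    g.inner (x * h) (mfderiv I I (· * h) x v) (mfderiv I I (· * h) x w) = g.inner x v w

/-- The metric `g` on a Lie group is bi-invariant. -/
def IsBiInvariant [IsManifold I ∞ G] (g : RiemMetric I G) : Prop :=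
  IsLeftInvariant g ∧ IsRightInvariant g

/-- The left translate to the identity of a tangent vector `v` at `x`. -/
noncomputable def leftTranslate (x : G) (v : TangentSpace I x) : GroupLieAlgebra I G :=
  (mfderiv I I (x⁻¹ * ·) x v : TangentSpace I (x⁻¹ * x))

/-- The left-invariant metric on a Lie group for which the left-invariant vector fields extending
the basis `e` of the Lie algebra are orthonormal. -/
noncomputable def leftInvariantMetricOfBasis {ι : Type*} [Fintype ι]
    (e : Module.Basis ι ℝ (GroupLieAlgebra I G)) : TwoTensor I G :=
  fun x v w => ∑ i, e.repr (leftTranslate x v) i * e.repr (leftTranslate x w) i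

end LieGroup

end Riemannian

/-- The group `U(1) × SU(2)`. -/
abbrev U1SU2 : Type := Circle × SU2

/-- The model with corners of `U(1) × SU(2)`. -/
noncomputable abbrev modelU1SU2 : ModelWithCorners ℝ (EuclideanSpace ℝ (Fin 1) × EuclideanSpace ℝ (Fin 3))
    (ModelProd (EuclideanSpace ℝ (Fin 1)) (EuclideanSpace ℝ (Fin 3))) := (𝓡 1).prod (𝓡 3)

/-- The model with corners of `ℝ × SU(2)`. -/
noncomputable abbrev modelRSU2 : ModelWithCorners ℝ (ℝ × EuclideanSpace ℝ (Fin 3))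
    (ModelProd ℝ (EuclideanSpace ℝ (Fin 3))) := 𝓘(ℝ, ℝ).prod (𝓡 3)

/-- The inclusion of the factor `u(1)` in the Lie algebra of `U(1) × SU(2)`. -/
noncomputable def inclU1 : GroupLieAlgebra (𝓡 1) Circle →ₗ[ℝ] GroupLieAlgebra modelU1SU2 U1SU2 :=
  LinearMap.inl ℝ (EuclideanSpace ℝ (Fin 1)) (EuclideanSpace ℝ (Fin 3))

/-- The inclusion of the factor `su(2)` in the Lie algebra of `U(1) × SU(2)`. -/
noncomputable def inclSU2 : GroupLieAlgebra (𝓡 3) SU2 →ₗ[ℝ] GroupLieAlgebra modelU1SU2 U1SU2 :=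
  LinearMap.inr ℝ (EuclideanSpace ℝ (Fin 1)) (EuclideanSpace ℝ (Fin 3))

/-- The vector of `u(1)` with exponential `t ↦ exp (i κ t)`. -/
noncomputable def u1Vector (κ : ℝ) : GroupLieAlgebra (𝓡 1) Circle :=
  (mfderiv 𝓘(ℝ, ℝ) (𝓡 1) (fun t : ℝ => Circle.exp (κ * t)) 0 (1 : ℝ) :
    TangentSpace (𝓡 1) (Circle.exp (κ * 0)))

/-- The universal covering `ℝ × SU(2) → U(1) × SU(2)`, `(t, A) ↦ (exp (t e₀), A)`, where `e₀` is
the vector `u1Vector κ` of `u(1)`, so that `∂/∂t` is mapped to `e₀`. -/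
noncomputable def covering (κ : ℝ) (p : ℝ × SU2) : U1SU2 := (Circle.exp (κ * p.1), p.2)

/-- The Euclidean metric on `ℝ`, for which `∂/∂t` has length one. -/
def euclideanMetricR : TwoTensor 𝓘(ℝ, ℝ) ℝ := fun _ (v w : ℝ) => v * w

/-! Write `X` for `Ê₀`, and let `(s, v)` be tangent at `(t, A)`, where `y` is the left translate of
`v` to the identity. Differentiating the composite of the map with the covering, and translating the
result to the identity, gives `s (a e₀ + X) + Ad(exp(-tX)) y = s E₀ + Ad(exp(-tX)) y`
(`flatDeriv_translate_covering_twistMap`). As `E₀` is a unit vector orthogonal to `su(2)`, its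
squared `gₗ`-length is `s²` plus that of `Ad(exp(-tX)) y`. So everything reduces to the invariance
of `gₗ` on `su(2)` under `Ad(exp(-tX))`.

Bi-invariance makes `Ad` orthogonal for `g₀`. If all `λᵢ` agree, `gₗ` is a multiple of `g₀` on
`su(2)`. Otherwise twistedness makes `X` a multiple of `u_k`, so `Ad(exp(-tX))` fixes `u_k` and
preserves the coordinate along it; `gₗ` is a combination of `g₀` and the square of that coordinate
(`diagonal_form_invariant`).

All tangent spaces are identified with the model space by `flatDeriv` and `flatInner`, so that base
points such as `x⁻¹ * x` can be rewritten to `1`. -/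

/-! ### Differentials as maps of model spaces. -/

section FlatDerivative

variable {E : Type*} [NormedAddCommGroup E] [NormedSpace ℝ E] {H : Type*} [TopologicalSpace H]
  {F : Type*} [NormedAddCommGroup F] [NormedSpace ℝ F] {H' : Type*} [TopologicalSpace H']
  {K : Type*} [NormedAddCommGroup K] [NormedSpace ℝ K] {H'' : Type*} [TopologicalSpace H'']
  {M : Type*} [TopologicalSpace M] [ChartedSpace H M]
  {N : Type*} [TopologicalSpace N] [ChartedSpace H' N]
  {P : Type*} [TopologicalSpace P] [ChartedSpace H'' P]

/-- The manifold derivative of `f` at `x`, as a map between the model vector spaces. -/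
noncomputable def flatDeriv (I : ModelWithCorners ℝ E H) (J : ModelWithCorners ℝ F H')
    (f : M → N) (x : M) : E →L[ℝ] F :=
  mfderiv I J f x

variable {I : ModelWithCorners ℝ E H} {J : ModelWithCorners ℝ F H'} {L : ModelWithCorners ℝ K H''}

theorem flatDeriv_comp {g : N → P} {f : M → N} {x : M} (hg : MDifferentiable J L g)
    (hf : MDifferentiable I J f) (v : E) :
    flatDeriv I L (fun z => g (f z)) x v = flatDeriv J L g (f x) (flatDeriv I J f x v) :=
  congrArg (fun T : E →L[ℝ] K => T v) (mfderiv_comp x (hg (f x)) (hf x))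

theorem flatDeriv_id (x : M) (v : E) : flatDeriv I I (fun z : M => z) x v = v :=
  congrArg (fun T : E →L[ℝ] E => T v) (mfderiv_id (I := I) (x := x))

theorem flatDeriv_const (c : N) (x : M) : flatDeriv I J (fun _ : M => c) x = 0 :=
  mfderiv_const

theorem flatDeriv_prodMk {f : M → N} {g : M → P} (hf : MDifferentiable I J f)
    (hg : MDifferentiable I L g) (x : M) (v : E) :
    flatDeriv I (J.prod L) (fun z => (f z, g z)) x v =
      (flatDeriv I J f x v, flatDeriv I L g x v) :=
  congrArg (fun T : E →L[ℝ] F × K => T v) ((hf x).mfderiv_prod (hg x))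

theorem flatDeriv_prod_eq_add {f : M × N → P} (hf : MDifferentiable (I.prod J) L f)
    (p : M × N) (v : E × F) :
    flatDeriv (I.prod J) L f p v =
      flatDeriv I L (fun z => f (z, p.2)) p.1 v.1 + flatDeriv J L (fun z => f (p.1, z)) p.2 v.2 :=
  mfderiv_prod_eq_add_apply (hf p)

theorem flatDeriv_of_hasDerivAt {f : ℝ → F} {t : ℝ} {f' : F} (h : HasDerivAt f f' t) (s : ℝ) :
    flatDeriv 𝓘(ℝ, ℝ) 𝓘(ℝ, F) f t s = s • f' := by
  have h1 : flatDeriv 𝓘(ℝ, ℝ) 𝓘(ℝ, F) f t = fderiv ℝ f t := mfderiv_eq_fderiv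
  rw [h1, h.hasFDerivAt.fderiv]
  simp

variable [IsManifold I ∞ M]

/-- The bilinear form of a metric at a point, on the model vector space. -/
noncomputable def RiemMetric.flatInner (g : RiemMetric I M) (x : M) : E →L[ℝ] E →L[ℝ] ℝ :=
  g.inner x

end FlatDerivative

/-! ### Invariant metrics and the adjoint action. -/

section LieGroup

variable {E : Type*} [NormedAddCommGroup E] [NormedSpace ℝ E] {H : Type*} [TopologicalSpace H]
  {I : ModelWithCorners ℝ E H}
  {G : Type*} [TopologicalSpace G] [ChartedSpace H G] [Group G] [LieGroup I ∞ G]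

theorem mdifferentiable_mul_left' (h : G) : MDifferentiable I I (fun x : G => h * x) :=
  (contMDiff_mul_left (I := I) (n := ∞)).mdifferentiable (by simp)

theorem mdifferentiable_mul_right' (h : G) : MDifferentiable I I (fun x : G => x * h) :=
  (contMDiff_mul_right (I := I) (n := ∞)).mdifferentiable (by simp)

variable (I) in
/-- The adjoint action of `h⁻¹` on the Lie algebra: the differential at `1` of `x ↦ h⁻¹ x h`. -/
noncomputable def adInv (h : G) : E →L[ℝ] E := flatDeriv I I (fun x : G => h⁻¹ * x * h) 1

theorem mdifferentiable_conj (h : G) : MDifferentiable I I (fun x : G => h⁻¹ * x * h) :=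
  (mdifferentiable_mul_right' h).comp (mdifferentiable_mul_left' h⁻¹)

/-- Chain rule: the translation takes `x` to `1`, where the conjugation is differentiated. This is
the form in which `Ad` enters the differential of the twisted map. -/
theorem flatDeriv_translate_conj (h x : G) (v : E) :
    flatDeriv I I (fun z : G => h⁻¹ * (x⁻¹ * z) * h) x v =
      adInv I h (flatDeriv I I (fun z : G => x⁻¹ * z) x v) := by
  rw [flatDeriv_comp (g := fun z : G => h⁻¹ * z * h) (mdifferentiable_conj h)
    (mdifferentiable_mul_left' x⁻¹), inv_mul_cancel]
  rfl

theorem IsLeftInvariant.flatInner_eq {g : RiemMetric I G} (hg : IsLeftInvariant g) (x : G)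
    (v w : E) :
    g.flatInner x v w = g.flatInner 1 (flatDeriv I I (fun z : G => x⁻¹ * z) x v)
      (flatDeriv I I (fun z : G => x⁻¹ * z) x w) := by
  have h : g.flatInner (x⁻¹ * x) (flatDeriv I I (fun z : G => x⁻¹ * z) x v)
      (flatDeriv I I (fun z : G => x⁻¹ * z) x w) = g.flatInner x v w := hg x⁻¹ x v w
  rw [← h, inv_mul_cancel]

/-- Conjugation is a right translation by `h` followed by a left translation by `h⁻¹`, and both are
isometries. -/
theorem IsBiInvariant.flatInner_adInv {g : RiemMetric I G} (hg : IsBiInvariant g) (h : G)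
    (v w : E) : g.flatInner 1 (adInv I h v) (adInv I h w) = g.flatInner 1 v w := by
  have h1 : g.flatInner (1 * h) (flatDeriv I I (fun z : G => z * h) 1 v)
      (flatDeriv I I (fun z : G => z * h) 1 w) = g.flatInner 1 v w := hg.2 h 1 v w
  have h2 (v : E) : adInv I h v =
      flatDeriv I I (fun z : G => h⁻¹ * z) h (flatDeriv I I (fun z : G => z * h) 1 v) := by
    have := flatDeriv_comp (x := (1 : G)) (mdifferentiable_mul_left' (I := I) h⁻¹)
      (mdifferentiable_mul_right' h) v
    simp only [one_mul, ← mul_assoc] at this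
    exact this
  rw [h2, h2, ← hg.1.flatInner_eq, ← h1, one_mul]

end LieGroup

theorem Circle.lieGroup_infty : LieGroup (𝓡 1) ∞ Circle := LieGroup.of_le (n := ω) le_top

theorem SU2.lieGroup_infty : LieGroup (𝓡 3) ∞ SU2 := LieGroup.of_le (n := ω) le_top

section

attribute [local instance] Circle.lieGroup_infty SU2.lieGroup_infty

/-! ### One-parameter subgroups of `SU(2)`. -/

namespace SU2

theorem mdifferentiable_entries (i j : Fin 2) : MDifferentiable (𝓡 3) 𝓘(ℝ, ℂ)
    (fun A : SU2 => (A : Matrix (Fin 2) (Fin 2) ℂ) i j) :=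
  (contMDiff_entry i j).mdifferentiable (by simp)

theorem lieMatrix_eq_flatDeriv (X : EuclideanSpace ℝ (Fin 3)) (i j : Fin 2) : lieMatrix X i j =
    flatDeriv (𝓡 3) 𝓘(ℝ, ℂ) (fun A : SU2 => (A : Matrix (Fin 2) (Fin 2) ℂ) i j) 1 X :=
  rfl

theorem lieMatrix_smul (c : ℝ) (X : EuclideanSpace ℝ (Fin 3)) :
    lieMatrix (c • X) = c • lieMatrix X := by
  ext i j
  rw [Matrix.smul_apply, lieMatrix_eq_flatDeriv, lieMatrix_eq_flatDeriv, map_smul]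

/-- The map `SU(2) → S³ → ℝ⁴` is an immersion, and its coordinates are the real and imaginary parts
of the first column. Tangent vectors can therefore be compared through their matrices. -/
theorem lieMatrix_injective {X Y : EuclideanSpace ℝ (Fin 3)} (hXY : lieMatrix X = lieMatrix Y) :
    X = Y := by
  have hd : MDifferentiable (𝓡 3) (𝓡 3) homeoSphere := contMDiff_homeoSphere.mdifferentiable (by simp)
  have hd' : MDifferentiable (𝓡 3) (𝓡 3) homeoSphere.symm :=
    contMDiff_homeoSphere_symm.mdifferentiable (by simp)
  have hc : MDifferentiable (𝓡 3) 𝓘(ℝ, EuclideanSpace ℝ (Fin 4))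
      (fun x : Sphere3 => (x : EuclideanSpace ℝ (Fin 4))) :=
    (contMDiff_coe_sphere (n := 3) (m := ω)).mdifferentiable (by simp)
  have hleft (Z : EuclideanSpace ℝ (Fin 3)) :
      flatDeriv (𝓡 3) (𝓡 3) homeoSphere.symm (homeoSphere 1)
        (flatDeriv (𝓡 3) (𝓡 3) homeoSphere 1 Z) = Z := by
    rw [← flatDeriv_comp hd' hd]
    simp only [Homeomorph.symm_apply_apply]
    exact flatDeriv_id _ _
  rw [← hleft X, ← hleft Y]
  congr 1
  have hinj : Function.Injective
      (flatDeriv (𝓡 3) 𝓘(ℝ, EuclideanSpace ℝ (Fin 4))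
        (fun x : Sphere3 => (x : EuclideanSpace ℝ (Fin 4))) (homeoSphere 1)) :=
    injective_mvfderiv_subtypeVal_sphere (n := 3) (homeoSphere 1)
  apply hinj
  rw [← flatDeriv_comp hc hd, ← flatDeriv_comp hc hd]
  have hcoord (l : EuclideanSpace ℝ (Fin 4) →L[ℝ] ℝ) (L : ℂ →L[ℝ] ℝ) (i j : Fin 2)
      (h : ∀ A : SU2, l (homeoSphere A) = L ((A : Matrix (Fin 2) (Fin 2) ℂ) i j))
      (Z : EuclideanSpace ℝ (Fin 3)) :
      l (flatDeriv (𝓡 3) 𝓘(ℝ, EuclideanSpace ℝ (Fin 4))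
        (fun z : SU2 => (homeoSphere z : EuclideanSpace ℝ (Fin 4))) 1 Z) = L (lieMatrix Z i j) := by
    have hl (T : EuclideanSpace ℝ (Fin 4)) (S) : l S =
        flatDeriv 𝓘(ℝ, EuclideanSpace ℝ (Fin 4)) 𝓘(ℝ, ℝ) l T S := by
      have : flatDeriv 𝓘(ℝ, EuclideanSpace ℝ (Fin 4)) 𝓘(ℝ, ℝ) l T = l :=
        mfderiv_eq_fderiv.trans l.fderiv
      rw [this]
    have hcd : MDifferentiable (𝓡 3) 𝓘(ℝ, EuclideanSpace ℝ (Fin 4))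
      (fun z : SU2 => (homeoSphere z : EuclideanSpace ℝ (Fin 4))) := hc.comp hd
    rw [hl (homeoSphere 1), ← flatDeriv_comp (g := l) l.differentiable.mdifferentiable hcd]
    simp only [h]
    exact mvfderiv_clm i j L Z
  ext k
  fin_cases k
  · exact (hcoord (EuclideanSpace.proj 0) Complex.reCLM 0 0 (fun A => rfl) X).trans
      ((congrArg (fun m : Matrix _ _ ℂ => Complex.reCLM (m 0 0)) hXY).trans
        (hcoord (EuclideanSpace.proj 0) Complex.reCLM 0 0 (fun A => rfl) Y).symm)
  · exact (hcoord (EuclideanSpace.proj 1) Complex.imCLM 0 0 (fun A => rfl) X).trans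
      ((congrArg (fun m : Matrix _ _ ℂ => Complex.imCLM (m 0 0)) hXY).trans
        (hcoord (EuclideanSpace.proj 1) Complex.imCLM 0 0 (fun A => rfl) Y).symm)
  · exact (hcoord (EuclideanSpace.proj 2) Complex.reCLM 1 0 (fun A => rfl) X).trans
      ((congrArg (fun m : Matrix _ _ ℂ => Complex.reCLM (m 1 0)) hXY).trans
        (hcoord (EuclideanSpace.proj 2) Complex.reCLM 1 0 (fun A => rfl) Y).symm)
  · exact (hcoord (EuclideanSpace.proj 3) Complex.imCLM 1 0 (fun A => rfl) X).trans
      ((congrArg (fun m : Matrix _ _ ℂ => Complex.imCLM (m 1 0)) hXY).trans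
        (hcoord (EuclideanSpace.proj 3) Complex.imCLM 1 0 (fun A => rfl) Y).symm)

theorem coe_lieExp_smul (X : EuclideanSpace ℝ (Fin 3)) (t : ℝ) :
    (lieExp (t • X) : Matrix (Fin 2) (Fin 2) ℂ) = NormedSpace.exp (t • lieMatrix X) := by
  rw [← lieMatrix_smul]
  rfl

theorem lieExp_add_smul (X : EuclideanSpace ℝ (Fin 3)) (s t : ℝ) :
    lieExp ((s + t) • X) = lieExp (s • X) * lieExp (t • X) := by
  apply Subtype.ext
  rw [Submonoid.coe_mul, coe_lieExp_smul, coe_lieExp_smul, coe_lieExp_smul, add_smul,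
    Matrix.exp_add_of_commute]
  exact ((Commute.refl (lieMatrix X)).smul_left s).smul_right t

theorem lieExp_zero_smul (X : EuclideanSpace ℝ (Fin 3)) : lieExp ((0 : ℝ) • X) = 1 := by
  apply Subtype.ext
  rw [coe_lieExp_smul]
  simp

theorem lieExp_neg_smul (X : EuclideanSpace ℝ (Fin 3)) (t : ℝ) :
    lieExp ((-t) • X) = (lieExp (t • X))⁻¹ := by
  rw [eq_inv_iff_mul_eq_one, ← lieExp_add_smul, neg_add_cancel, lieExp_zero_smul]

open scoped Matrix.Norms.Operator in
theorem contDiff_exp_smul_entry (M : Matrix (Fin 2) (Fin 2) ℂ) (i j : Fin 2) :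
    ContDiff ℝ ∞ fun t : ℝ => NormedSpace.exp (t • M) i j := by
  have h : ContDiff ℝ ∞ fun t : ℝ => NormedSpace.exp (t • M) := by
    have h1 : ContDiff ℝ ∞ (NormedSpace.exp : Matrix (Fin 2) (Fin 2) ℂ → _) :=
      contDiff_iff_contDiffAt.2 fun x => (NormedSpace.exp_analytic (𝕂 := ℝ) x).contDiffAt
    exact h1.comp (contDiff_id.smul contDiff_const)
  exact (Matrix.entryLinearMap ℝ ℂ i j).toContinuousLinearMap.contDiff.comp h

/-- Composing with a continuous linear map, later a matrix entry, leaves a derivative in which no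
norm on matrices appears. -/
theorem _root_.hasDerivAt_clm_exp_smul {A F : Type*} [NormedRing A] [NormedAlgebra ℝ A] [CompleteSpace A]
    [NormedAddCommGroup F] [NormedSpace ℝ F] (L : A →L[ℝ] F) (M : A) :
    HasDerivAt (fun t : ℝ => L (NormedSpace.exp (t • M))) (L M) 0 := by
  have h : HasDerivAt (fun t : ℝ => NormedSpace.exp (t • M)) M 0 := by
    simpa using hasDerivAt_exp_smul_const M (0 : ℝ)
  exact L.hasFDerivAt.comp_hasDerivAt 0 h

open scoped Matrix.Norms.Operator in
theorem hasDerivAt_exp_smul_entry (M : Matrix (Fin 2) (Fin 2) ℂ) (i j : Fin 2) :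
    HasDerivAt (fun t : ℝ => NormedSpace.exp (t • M) i j) (M i j) 0 :=
  hasDerivAt_clm_exp_smul (Matrix.entryLinearMap ℝ ℂ i j).toContinuousLinearMap M

theorem contMDiff_lieExp_smul (X : EuclideanSpace ℝ (Fin 3)) :
    ContMDiff 𝓘(ℝ, ℝ) (𝓡 3) ∞ fun t : ℝ => lieExp (t • X) := by
  refine contMDiff_of_entries fun i j => ?_
  simp only [coe_lieExp_smul]
  exact (contDiff_exp_smul_entry _ i j).contMDiff

theorem mdifferentiable_lieExp_smul (X : EuclideanSpace ℝ (Fin 3)) :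
    MDifferentiable 𝓘(ℝ, ℝ) (𝓡 3) fun t : ℝ => lieExp (t • X) :=
  (contMDiff_lieExp_smul X).mdifferentiable (by simp)

/-- Both sides have the same matrix, since `exp (t M)` has derivative `M` at `0`. This ties the
matrix exponential to the tangent vector that it came from. -/
theorem flatDeriv_lieExp_smul_zero (X : EuclideanSpace ℝ (Fin 3)) (s : ℝ) :
    flatDeriv 𝓘(ℝ, ℝ) (𝓡 3) (fun t : ℝ => lieExp (t • X)) 0 s = s • X := by
  apply lieMatrix_injective
  rw [lieMatrix_smul]
  ext i j
  have h := flatDeriv_comp (x := (0 : ℝ)) (mdifferentiable_entries i j)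
    (mdifferentiable_lieExp_smul X) s
  rw [lieExp_zero_smul] at h
  rw [lieMatrix_eq_flatDeriv, ← h]
  simp only [coe_lieExp_smul]
  exact flatDeriv_of_hasDerivAt (hasDerivAt_exp_smul_entry _ i j) s

/-- Conjugation by `exp (tX)` fixes each `exp (sX)`; differentiate at `s = 0`. -/
theorem adInv_lieExp_smul_self (X : EuclideanSpace ℝ (Fin 3)) (t : ℝ) :
    adInv (𝓡 3) (lieExp (t • X)) X = X := by
  have h := flatDeriv_comp (x := (0 : ℝ)) (mdifferentiable_conj (I := 𝓡 3) (lieExp (t • X)))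
    (mdifferentiable_lieExp_smul X) 1
  have hc (s : ℝ) : (lieExp (t • X))⁻¹ * lieExp (s • X) * lieExp (t • X) = lieExp (s • X) := by
    rw [← lieExp_neg_smul, ← lieExp_add_smul, ← lieExp_add_smul]
    congr 2
    ring
  simp only [hc] at h
  rw [flatDeriv_lieExp_smul_zero, lieExp_zero_smul, one_smul] at h
  exact h.symm

theorem flatDeriv_lieExp_sub_smul (X : EuclideanSpace ℝ (Fin 3)) (t s : ℝ) :
    flatDeriv 𝓘(ℝ, ℝ) (𝓡 3) (fun r : ℝ => lieExp ((r - t) • X)) t s = s • X := by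
  have hd : MDifferentiable 𝓘(ℝ, ℝ) 𝓘(ℝ, ℝ) (fun r : ℝ => r - t) :=
    (differentiable_id.sub_const t).mdifferentiable
  rw [flatDeriv_comp (f := fun r : ℝ => r - t) (mdifferentiable_lieExp_smul X) hd, sub_self,
    flatDeriv_lieExp_smul_zero,
    flatDeriv_of_hasDerivAt ((hasDerivAt_id' t).sub_const t)]
  simp

end SU2

/-! ### The twisted diffeomorphism and its differential. -/

theorem contMDiff_covering (κ : ℝ) : ContMDiff modelRSU2 modelU1SU2 ∞ (covering κ) := by
  have h1 : ContMDiff modelRSU2 (𝓡 1) ∞ fun p : ℝ × SU2 => Circle.exp (κ * p.1) :=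
    contMDiff_circleExp.comp ((contDiff_const.mul contDiff_id).contMDiff.comp contMDiff_fst)
  exact h1.prodMk contMDiff_snd

/-- The map `(t, A) ↦ (a t, A exp (t X))` of `ℝ × SU(2)`. -/
noncomputable def twistMap (a : ℝ) (X : EuclideanSpace ℝ (Fin 3)) (p : ℝ × SU2) : ℝ × SU2 :=
  (a * p.1, p.2 * SU2.lieExp (p.1 • X))

theorem contMDiff_twistMap (a : ℝ) (X : EuclideanSpace ℝ (Fin 3)) :
    ContMDiff modelRSU2 modelRSU2 ∞ (twistMap a X) := by
  have h1 : ContMDiff modelRSU2 𝓘(ℝ, ℝ) ∞ fun p : ℝ × SU2 => a * p.1 :=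
    (contDiff_const.mul contDiff_id).contMDiff.comp contMDiff_fst
  exact h1.prodMk (contMDiff_snd.mul ((SU2.contMDiff_lieExp_smul X).comp contMDiff_fst))

/-- The map `(t, A) ↦ (a t, A exp (t X))`, for `a ≠ 0`, as a diffeomorphism. -/
noncomputable def twistDiffeomorph (a : ℝ) (ha : a ≠ 0) (X : EuclideanSpace ℝ (Fin 3)) :
    Diffeomorph modelRSU2 modelRSU2 (ℝ × SU2) (ℝ × SU2) ∞ where
  toFun := twistMap a X
  -- Solving `(s, B) = (a t, A exp (tX))` gives `t = s / a` and `A = B exp (-(s / a) X)`, a map of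
  -- the same shape.
  invFun := twistMap a⁻¹ ((-a⁻¹) • X)
  left_inv p := by
    have h : (a * p.1) • (-a⁻¹) • X = (-p.1) • X := by
      rw [smul_smul]
      congr 1
      field_simp
    simp only [twistMap, h, SU2.lieExp_neg_smul, mul_inv_cancel_right]
    rw [inv_mul_cancel_left₀ ha]
  right_inv p := by
    have h : p.1 • (-a⁻¹) • X = (-(a⁻¹ * p.1)) • X := by
      rw [smul_smul]
      congr 1
      ring
    simp only [twistMap, h, SU2.lieExp_neg_smul, inv_mul_cancel_right]
    rw [mul_inv_cancel_left₀ ha]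
  contMDiff_toFun := contMDiff_twistMap _ _
  contMDiff_invFun := contMDiff_twistMap _ _

theorem flatDeriv_circleExp (κ a t s : ℝ) :
    flatDeriv 𝓘(ℝ, ℝ) (𝓡 1) (fun r : ℝ => Circle.exp (κ * (a * (r - t)))) t s =
      (s * a) • (show EuclideanSpace ℝ (Fin 1) from u1Vector κ) := by
  have hd : MDifferentiable 𝓘(ℝ, ℝ) 𝓘(ℝ, ℝ) (fun r : ℝ => a * (r - t)) :=
    ((differentiable_id.sub_const t).const_mul a).mdifferentiable
  have hE : MDifferentiable 𝓘(ℝ, ℝ) (𝓡 1) (fun r : ℝ => Circle.exp (κ * r)) :=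
    (contMDiff_circleExp.comp (contDiff_const.mul contDiff_id).contMDiff).mdifferentiable
      (n := ∞) (by simp)
  have hu : flatDeriv 𝓘(ℝ, ℝ) (𝓡 1) (fun r : ℝ => Circle.exp (κ * r)) 0 1 =
      (show EuclideanSpace ℝ (Fin 1) from u1Vector κ) := rfl
  rw [flatDeriv_comp (g := fun r : ℝ => Circle.exp (κ * r)) hE hd, sub_self, mul_zero,
    flatDeriv_of_hasDerivAt (((hasDerivAt_id' t).sub_const t).const_mul a), ← hu]
  rw [mul_one, smul_eq_mul, ← map_smul, smul_eq_mul, mul_one]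

/-- The left translate to the identity of the differential of `(t, A) ↦ (exp (a t e₀), A exp (t X))`. -/
theorem flatDeriv_translate_covering_twistMap (κ a : ℝ) (X : EuclideanSpace ℝ (Fin 3))
    (p : ℝ × SU2) (v : ℝ × EuclideanSpace ℝ (Fin 3)) :
    flatDeriv modelRSU2 modelU1SU2
        (fun z => (covering κ (twistMap a X p))⁻¹ * covering κ (twistMap a X z)) p v =
      ((v.1 * a) • (show EuclideanSpace ℝ (Fin 1) from u1Vector κ),
        v.1 • X + adInv (𝓡 3) (SU2.lieExp (p.1 • X))
          (flatDeriv (𝓡 3) (𝓡 3) (fun z : SU2 => p.2⁻¹ * z) p.2 v.2)) := by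
  -- On the circle the exponential is a homomorphism, so translation merely shifts the parameter.
  have h : (fun z => (covering κ (twistMap a X p))⁻¹ * covering κ (twistMap a X z)) =
      fun z : ℝ × SU2 => (Circle.exp (κ * (a * (z.1 - p.1))),
        (p.2 * SU2.lieExp (p.1 • X))⁻¹ * (z.2 * SU2.lieExp (z.1 • X))) := by
    funext z
    refine Prod.ext ?_ rfl
    change (Circle.exp (κ * (a * p.1)))⁻¹ * Circle.exp (κ * (a * z.1)) = _
    rw [← Circle.exp_neg, ← Circle.exp_add]
    congr 1
    ring
  have hc : MDifferentiable modelRSU2 (𝓡 1)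
      fun z : ℝ × SU2 => Circle.exp (κ * (a * (z.1 - p.1))) :=
    (contMDiff_circleExp.comp ((contDiff_const.mul (contDiff_const.mul
      (contDiff_id.sub contDiff_const))).contMDiff.comp contMDiff_fst)).mdifferentiable
      (n := ∞) (by simp)
  have hs : MDifferentiable modelRSU2 (𝓡 3) fun z : ℝ × SU2 =>
      (p.2 * SU2.lieExp (p.1 • X))⁻¹ * (z.2 * SU2.lieExp (z.1 • X)) :=
    (contMDiff_const.mul (contMDiff_snd.mul
      ((SU2.contMDiff_lieExp_smul X).comp contMDiff_fst))).mdifferentiable (n := ∞) (by simp)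
  rw [h, flatDeriv_prodMk hc hs, flatDeriv_prod_eq_add hc, flatDeriv_prod_eq_add hs]
  refine Prod.ext ?_ ?_
  · simp only [flatDeriv_const, flatDeriv_circleExp]
    exact add_zero _
  -- The two partial maps: varying the time gives a shifted one-parameter subgroup, with derivative
  -- `X`; varying the group element gives a conjugation, hence `adInv`.
  · have h1 (r : ℝ) : (p.2 * SU2.lieExp (p.1 • X))⁻¹ * (p.2 * SU2.lieExp (r • X)) =
        SU2.lieExp ((r - p.1) • X) := by
      rw [mul_inv_rev, mul_assoc, inv_mul_cancel_left, ← SU2.lieExp_neg_smul,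
        ← SU2.lieExp_add_smul, neg_add_eq_sub]
    have h2 (z : SU2) : (p.2 * SU2.lieExp (p.1 • X))⁻¹ * (z * SU2.lieExp (p.1 • X)) =
        (SU2.lieExp (p.1 • X))⁻¹ * (p.2⁻¹ * z) * SU2.lieExp (p.1 • X) := by
      group
    simp only [h1, h2, SU2.flatDeriv_lieExp_sub_smul, flatDeriv_translate_conj]

/-! ### Adjoint invariance of metrics on `su(2)`. -/

/-- The embedding `z ↦ (1, z)` intertwines conjugation by `h` with conjugation by `(1, h)`. It
carries the bi-invariance of `g₀` over to `su(2)`. -/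
theorem adInv_prod (h : SU2) (v : EuclideanSpace ℝ (Fin 3)) :
    adInv modelU1SU2 ((1, h) : U1SU2) (0, v) = (0, adInv (𝓡 3) h v) := by
  have hj : MDifferentiable (𝓡 3) modelU1SU2 fun z : SU2 => ((1, z) : U1SU2) :=
    (contMDiff_const.prodMk contMDiff_id).mdifferentiable (n := ∞) (by simp)
  have hi (f : SU2 → SU2) (hf : MDifferentiable (𝓡 3) (𝓡 3) f) :
      flatDeriv (𝓡 3) modelU1SU2 (fun z : SU2 => ((1, f z) : U1SU2)) 1 v =
        (0, flatDeriv (𝓡 3) (𝓡 3) f 1 v) := by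
    rw [flatDeriv_prodMk (g := f) (contMDiff_const.mdifferentiable (n := ∞) (by simp)) hf,
      flatDeriv_const]
    rfl
  have h1 := hi (fun z => z) (contMDiff_id.mdifferentiable (n := ∞) (by simp))
  rw [flatDeriv_id] at h1
  rw [← h1]
  have h2 := flatDeriv_comp (x := (1 : SU2)) (mdifferentiable_conj (I := modelU1SU2) ((1, h) : U1SU2)) hj v
  have h3 := hi _ (mdifferentiable_conj (I := 𝓡 3) h)
  refine Eq.trans h2.symm (Eq.trans ?_ h3)
  congr 2
  funext z
  simp

/-- The restriction to `su(2)` of the bilinear form of a metric at the identity. -/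
noncomputable def RiemMetric.onSU2 (g : RiemMetric modelU1SU2 U1SU2) :
    EuclideanSpace ℝ (Fin 3) →L[ℝ] EuclideanSpace ℝ (Fin 3) →L[ℝ] ℝ :=
  (g.flatInner 1).bilinearComp (.inr ℝ _ _) (.inr ℝ _ _)

theorem RiemMetric.onSU2_apply (g : RiemMetric modelU1SU2 U1SU2)
    (v w : EuclideanSpace ℝ (Fin 3)) : g.onSU2 v w = g.flatInner 1 (0, v) (0, w) := rfl

theorem IsBiInvariant.onSU2_adInv {g : RiemMetric modelU1SU2 U1SU2} (hg : IsBiInvariant g) (h : SU2)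
    (v w : EuclideanSpace ℝ (Fin 3)) :
    g.onSU2 (adInv (𝓡 3) h v) (adInv (𝓡 3) h w) = g.onSU2 v w := by
  rw [RiemMetric.onSU2_apply, RiemMetric.onSU2_apply, ← adInv_prod, ← adInv_prod,
    hg.flatInner_adInv]

theorem RiemMetric.flatInner_symm (g : RiemMetric modelU1SU2 U1SU2) (x : U1SU2)
    (v w : EuclideanSpace ℝ (Fin 1) × EuclideanSpace ℝ (Fin 3)) :
    g.flatInner x v w = g.flatInner x w v :=
  g.symm x v w

/-- A form diagonal in `u`, two of whose eigenvalues agree, is invariant under the isometries of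
the form in which `u` is orthonormal that fix the remaining vector. -/
theorem diagonal_form_invariant {V : Type*} (B₀ B : V → V → ℝ) (u : Fin 3 → V) (mu : Fin 3 → ℝ)
    (h₀ : ∀ v w, B₀ v w = ∑ i, B₀ (u i) v * B₀ (u i) w)
    (h : ∀ v w, B v w = ∑ i, mu i * (B₀ (u i) v * B₀ (u i) w))
    (A : V → V) (hA : ∀ v w, B₀ (A v) (A w) = B₀ v w)
    (htw : (mu 0 = mu 1 ∧ mu 1 = mu 2) ∨
      ∃ i j k : Fin 3, i ≠ j ∧ j ≠ k ∧ i ≠ k ∧ mu i = mu j ∧ A (u k) = u k) (v w : V) :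
    B (A v) (A w) = B v w := by
  have e := hA v w
  rw [h₀, h₀ v] at e
  rw [h, h]
  simp only [Fin.sum_univ_three] at e ⊢
  obtain ⟨h1, h2⟩ | ⟨i, j, k, hij, hjk, hik, hm, hk⟩ := htw
  · rw [h1, h2]
    linear_combination mu 2 * e
  -- The `u k`-coordinate is preserved, so `e` says that the other two terms have a preserved sum;
  -- in `B` they carry the common coefficient `mu j`, which is the multiplier of `e` in each of the
  -- six cases.
  · have hv (v : V) : B₀ (u k) (A v) = B₀ (u k) v := by rw [← hA (u k) v, hk]
    have hv1 := hv v
    have hw1 := hv w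
    fin_cases i <;> fin_cases j <;> fin_cases k <;> simp at hij hjk hik hm hv1 hw1 <;>
      simp only [hv1, hw1] at e ⊢ <;> rw [hm]
    · linear_combination mu 1 * e
    · linear_combination mu 2 * e
    · linear_combination mu 0 * e
    · linear_combination mu 2 * e
    · linear_combination mu 0 * e
    · linear_combination mu 1 * e

/-- Extracts from twistedness that `Ê₀` is a multiple of `e k`, by projecting to `su(2)`. -/
theorem snd_eq_of_mem_span_pair {a : ℝ} {e : Fin 3 → EuclideanSpace ℝ (Fin 3)} {b : Fin 3 → ℝ}
    {k : Fin 3} {w : EuclideanSpace ℝ (Fin 1)}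
    (h : ((a • w, ∑ i, b i • e i) : EuclideanSpace ℝ (Fin 1) × EuclideanSpace ℝ (Fin 3)) ∈
      Submodule.span ℝ {(w, 0), (0, e k)}) : ∃ c : ℝ, ∑ i, b i • e i = c • e k := by
  obtain ⟨p, q, hpq⟩ := Submodule.mem_span_pair.1 h
  refine ⟨q, ?_⟩
  have := congrArg Prod.snd hpq
  simpa using this.symm

end

/-! ### The isometry. -/

theorem proposition4p5
    (g₀ gₗ : RiemMetric modelU1SU2 U1SU2) (hg₀ : IsBiInvariant g₀) (hgₗ : IsLeftInvariant gₗ)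
    -- a `g₀`-orthonormal basis of `su(2)` of eigenvectors of the restriction of `gₗ` to `su(2)`,
    -- with eigenvalues `(lam i) ^ 2`, and the corresponding `gₗ`-orthonormal basis `e`
    (u : Fin 3 → GroupLieAlgebra (𝓡 3) SU2) (lam : Fin 3 → ℝ) (hlam : ∀ i, 0 < lam i)
    (hu : ∀ i j, g₀.inner 1 (inclSU2 (u i)) (inclSU2 (u j)) = if i = j then 1 else 0)
    (heig : ∀ (i : Fin 3) (v : GroupLieAlgebra (𝓡 3) SU2),
      gₗ.inner 1 (inclSU2 (u i)) (inclSU2 v) =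
        lam i ^ 2 * g₀.inner 1 (inclSU2 (u i)) (inclSU2 v))
    (e : Module.Basis (Fin 3) ℝ (GroupLieAlgebra (𝓡 3) SU2)) (he : ∀ i, e i = (lam i)⁻¹ • u i)
    -- `e₀ = u1Vector κ` is an arbitrary vector spanning `u(1)`
    (κ : ℝ) (hκ : κ ≠ 0)
    -- `E₀` is a unit vector orthogonal to `su(2)`
    (E₀ : GroupLieAlgebra modelU1SU2 U1SU2)
    (hE₀ : ∀ v : GroupLieAlgebra (𝓡 3) SU2, gₗ.inner 1 E₀ (inclSU2 v) = 0)
    (hE₀' : gₗ.inner 1 E₀ E₀ = 1)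
    (a : ℝ) (b : Fin 3 → ℝ)
    (hab : E₀ = a • inclU1 (u1Vector κ) + ∑ i, b i • inclSU2 (e i))
    -- `gₗ` is twisted
    (htw : (lam 0 = lam 1 ∧ lam 1 = lam 2) ∨
      ∃ i j k : Fin 3, i ≠ j ∧ j ≠ k ∧ i ≠ k ∧ lam i = lam j ∧
        E₀ ∈ Submodule.span ℝ {inclU1 (u1Vector κ), inclSU2 (e k)})
    (hcurv : HasNonnegSectionalCurvature gₗ) :
    IsRiemannianIsometry
      (euclideanMetricR.prod (leftInvariantMetricOfBasis e) : TwoTensor modelRSU2 (ℝ × SU2))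
      (TwoTensor.pullback (I := modelRSU2) gₗ.toTwoTensor (covering κ))
      (fun p : ℝ × SU2 => (a * p.1, p.2 * SU2.lieExp (p.1 • ∑ i, b i • e i))) := by
  have := Circle.lieGroup_infty
  have := SU2.lieGroup_infty
  set V := EuclideanSpace ℝ (Fin 3)
  -- The same vectors, viewed in the model space where the flat lemmas apply.
  let u' : Fin 3 → V := u
  let e' : Module.Basis (Fin 3) ℝ V := e
  let X : V := ∑ i, b i • e' i
  let w₀ : EuclideanSpace ℝ (Fin 1) := u1Vector κ
  have hE : E₀ = (a • w₀, X) := by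
    rw [hab]
    simp only [← map_smul, ← map_sum]
    refine Prod.ext ?_ ?_
    · exact add_zero _
    · exact zero_add _
  have he' (i : Fin 3) : e' i = (lam i)⁻¹ • u' i := he i
  have hu' (i j : Fin 3) : g₀.onSU2 (u' i) (u' j) = if i = j then 1 else 0 := hu i j
  have heig' (i : Fin 3) (v : V) : gₗ.onSU2 (u' i) v = lam i ^ 2 * g₀.onSU2 (u' i) v := heig i v
  have hE₀v (v : V) : gₗ.flatInner 1 (a • w₀, X) (0, v) = 0 := hE ▸ hE₀ v
  have hE₀1 : gₗ.flatInner 1 (a • w₀, X) (a • w₀, X) = 1 := hE ▸ hE₀'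
  have hexp (v : V) : v = ∑ i, (e'.repr v i * (lam i)⁻¹) • u' i := by
    conv_lhs => rw [← e'.sum_repr v]
    refine Finset.sum_congr rfl fun i _ => ?_
    rw [he', smul_smul]
  have hcoef (i : Fin 3) (v : V) : g₀.onSU2 (u' i) v = e'.repr v i * (lam i)⁻¹ := by
    conv_lhs => rw [hexp v]
    simp [hu']
  -- For `g = g₀` this is Parseval's identity; for `gₗ` the eigenvalue equation turns it into the
  -- diagonal form `hBl`.
  have hB (g : RiemMetric modelU1SU2 U1SU2) (v w : V) :
      g.onSU2 v w = ∑ i, g₀.onSU2 (u' i) v * g.onSU2 (u' i) w := by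
    conv_lhs => rw [hexp v]
    simp [hcoef]
  have hBl (v w : V) :
      gₗ.onSU2 v w = ∑ i, lam i ^ 2 * (g₀.onSU2 (u' i) v * g₀.onSU2 (u' i) w) := by
    rw [hB]
    refine Finset.sum_congr rfl fun i _ => ?_
    rw [heig']
    ring
  have hAd (t : ℝ) (v w : V) : gₗ.onSU2 (adInv (𝓡 3) (SU2.lieExp (t • X)) v)
      (adInv (𝓡 3) (SU2.lieExp (t • X)) w) = gₗ.onSU2 v w := by
    refine diagonal_form_invariant (fun v w => g₀.onSU2 v w) (fun v w => gₗ.onSU2 v w) u'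
      (fun i => lam i ^ 2) (hB g₀) hBl _ (hg₀.onSU2_adInv _) ?_ v w
    refine htw.imp (fun h => ?_) ?_
    · simp [h.1, h.2]
    · rintro ⟨i, j, k, hij, hjk, hik, hl, hmem⟩
      refine ⟨i, j, k, hij, hjk, hik, by simp [hl], ?_⟩
      rw [hE] at hmem
      obtain ⟨c, hc⟩ := snd_eq_of_mem_span_pair (e := e') hmem
      -- So `exp (tX)` lies in the one-parameter subgroup of `u' k`, whose adjoint action fixes `u'
      -- k`.
      have hX : t • X = (t * c * (lam k)⁻¹) • u' k := by
        change t • (∑ i, b i • e' i) = _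
        rw [hc, he', smul_smul, smul_smul, mul_assoc]
      rw [hX]
      exact SU2.adInv_lieExp_smul_self _ _
  -- If `a = 0`, the unit vector `E₀` lies in `su(2)` and is orthogonal to itself.
  have ha : a ≠ 0 := by
    rintro rfl
    have := hE₀v X
    rw [zero_smul] at this hE₀1
    rw [this] at hE₀1
    exact zero_ne_one hE₀1
  refine ⟨⟨twistDiffeomorph a ha X, rfl⟩, fun x (v w : ℝ × V) => ?_⟩
  have hD : MDifferentiable modelRSU2 modelRSU2 (twistMap a X) :=
    (contMDiff_twistMap a X).mdifferentiable (by simp)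
  have hC : MDifferentiable modelRSU2 modelU1SU2 (covering κ) :=
    (contMDiff_covering κ).mdifferentiable (by simp)
  have hCD : MDifferentiable modelRSU2 modelU1SU2 fun z => covering κ (twistMap a X z) :=
    hC.comp hD
  let l (v : ℝ × V) : V := flatDeriv (𝓡 3) (𝓡 3) (fun z : SU2 => x.2⁻¹ * z) x.2 v.2
  change gₗ.flatInner (covering κ (twistMap a X x))
      (flatDeriv modelRSU2 modelU1SU2 (covering κ) (twistMap a X x)
        (flatDeriv modelRSU2 modelRSU2 (twistMap a X) x v))
      (flatDeriv modelRSU2 modelU1SU2 (covering κ) (twistMap a X x)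
        (flatDeriv modelRSU2 modelRSU2 (twistMap a X) x w)) =
    v.1 * w.1 + ∑ i, e'.repr (l v) i * e'.repr (l w) i
  rw [← flatDeriv_comp hC hD, ← flatDeriv_comp hC hD, hgₗ.flatInner_eq,
    ← flatDeriv_comp (g := fun z => (covering κ (twistMap a X x))⁻¹ * z)
      (mdifferentiable_mul_left' _) hCD,
    ← flatDeriv_comp (g := fun z => (covering κ (twistMap a X x))⁻¹ * z)
      (mdifferentiable_mul_left' _) hCD,
    flatDeriv_translate_covering_twistMap, flatDeriv_translate_covering_twistMap]
  -- Decomposition along `E₀` and its orthogonal complement `su(2)`: the cross terms vanish.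
  have hsplit (s : ℝ) (y : V) : ((s * a) • w₀, s • X + y) = s • (a • w₀, X) + (0, y) := by
    simp [smul_smul]
  refine (congrArg₂ (fun p q => gₗ.flatInner 1 p q) (hsplit _ _) (hsplit _ _)).trans ?_
  simp only [map_add, map_smul, add_apply, smul_apply,
    hE₀v, hE₀1, gₗ.flatInner_symm 1 (0, _) (a • w₀, X)]
  rw [← RiemMetric.onSU2_apply, hAd, hBl]
  simp only [hcoef, smul_eq_mul, mul_zero, mul_one, add_zero, zero_add]
  rw [mul_comm]
  congr 1
  -- The factor `(lam i) ^ 2` cancels the two factors `(lam i)⁻¹` from `hcoef`: the basis `e` is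
  -- `gₗ`-orthonormal.
  refine Finset.sum_congr rfl fun i _ => ?_
  have := (hlam i).ne'
  field_simp
  rfl
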